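/- Let $\mathcal A$ be a complex Banach algebra (not assumed unital or commutative) and let $\varphi$ be a character on $\mathcal A$, i.e. a non-zero multiplicative bounded linear functional. For $f\in\mathcal A^*$ and $a\in\mathcal A$ define $f\cdot a,\ a\cdot f\in\mathcal A^*$ by $\langle f\cdot a,b\rangle=\langle f,ab\rangle$ and $\langle a\cdot f,b\rangle=\langle f,ba\rangle$. A topologically two-sided invariant $\varphi$-mean on $\mathcal A^*$ is an $m\in\mathcal A^{**}$ with $m(\varphi)=1$ and $\langle m,f\cdot a\rangle=\varphi(a)\langle m,f\rangle=\langle m,a\cdot f\rangle$ for all $f\in\mathcal A^*$, $a\in\mathcal A$. Suppose that: - $\mathcal A$ is separable and weakly sequentially complete (every weakly Cauchy sequence is weakly convergent); - $\mathcal A$ is faithful: for each $a\neq 0$ there are $b,c\in\mathcal A$ with $ab\neq 0$ and $ca\neq 0$; - the closed linear span of $\{ab : a\in\mathcal A,\ b\in I_\varphi\}$ equals $I_\varphi:=\{a\in\mathcal A:\varphi(a)=0\}$; - $\mathcal A$ is two-sided $\varphi$-amenable, i.e. there is a topologically two-sided invariant $\varphi$-mean on $\mathcal A^*$. Let $\mathcal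 A_M$ be the Banach algebra obtained by completing $\mathcal A$ in the multiplier norm $\|a\|_M=\sup_{\|b\|\le 1}\{\|ab\|,\|ba\|\}$. If $\mathcal A_M$ is Arens regular, i.e. the left and right Arens products on $\mathcal A_M^{**}$ coincide, then there is a unique topologically two-sided invariant $\varphi$-mean on $\mathcal A^*$, and it lies in $\mathcal A$: there is exactly one $m\in\mathcal A^{**}$ that is a topologically two-sided invariant $\varphi$-mean on $\mathcal A^*$, and exactly one $u\in\mathcal A$ whose canonical image in $\mathcal A^{**}$ is such a mean. -/

import Mathlib

open Filter Topology

noncomputable section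

namespace BanachMean

variable (A : Type*) [NonUnitalNormedRing A]

/-- `A` is faithful: for every `a ≠ 0` there are `b, c` with `a b ≠ 0` and `c a ≠ 0`. -/
def IsFaithful : Prop :=
  ∀ a : A, a ≠ 0 → (∃ b : A, a * b ≠ 0) ∧ ∃ c : A, c * a ≠ 0

variable [NormedSpace ℂ A]

/-- Every weakly Cauchy sequence converges weakly. -/
def IsWeaklySequentiallyComplete : Prop :=
  ∀ x : ℕ → A, (∀ f : StrongDual ℂ A, CauchySeq fun n => f (x n)) →
    ∃ y : A, ∀ f : StrongDual ℂ A, Tendsto (fun n => f (x n)) atTop (𝓝 (f y))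

variable [IsScalarTower ℂ A A] [SMulCommClass ℂ A A]

/-! ### Module actions on the dual, and the two Arens products -/

section Arens

/-- `dualMul f a` is the functional `f · a`, where `⟨f · a, b⟩ = ⟨f, a b⟩`. -/
def dualMul : StrongDual ℂ A →L[ℂ] A →L[ℂ] StrongDual ℂ A :=
  ((ContinuousLinearMap.compL ℂ A (A →L[ℂ] A) (StrongDual ℂ A)).flip
    (ContinuousLinearMap.mul ℂ A)).comp (ContinuousLinearMap.compL ℂ A A ℂ)

/-- `mulDual f a` is the functional `a · f`, where `⟨a · f, b⟩ = ⟨f, b a⟩`. -/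
def mulDual : StrongDual ℂ A →L[ℂ] A →L[ℂ] StrongDual ℂ A :=
  ((ContinuousLinearMap.compL ℂ A (A →L[ℂ] A) (StrongDual ℂ A)).flip
    (ContinuousLinearMap.mul ℂ A).flip).comp (ContinuousLinearMap.compL ℂ A A ℂ)

variable {A}

@[simp] theorem dualMul_apply (f : StrongDual ℂ A) (a b : A) :
    dualMul A f a b = f (a * b) := rfl

@[simp] theorem mulDual_apply (f : StrongDual ℂ A) (a b : A) :
    mulDual A f a b = f (b * a) := rfl

/-- The map `f ↦ n · f` on the dual, where `⟨n · f, a⟩ = ⟨n, f · a⟩`. -/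
def bidualMul (n : StrongDual ℂ (StrongDual ℂ A)) : StrongDual ℂ A →L[ℂ] StrongDual ℂ A :=
  (ContinuousLinearMap.compL ℂ A (StrongDual ℂ A) ℂ n).comp (dualMul A)

/-- The map `f ↦ f · n` on the dual, where `⟨f · n, a⟩ = ⟨n, a · f⟩`. -/
def mulBidual (n : StrongDual ℂ (StrongDual ℂ A)) : StrongDual ℂ A →L[ℂ] StrongDual ℂ A :=
  (ContinuousLinearMap.compL ℂ A (StrongDual ℂ A) ℂ n).comp (mulDual A)

@[simp] theorem bidualMul_apply (n : StrongDual ℂ (StrongDual ℂ A)) (f : StrongDual ℂ A) (a : A) :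
    bidualMul n f a = n (dualMul A f a) := rfl

@[simp] theorem mulBidual_apply (n : StrongDual ℂ (StrongDual ℂ A)) (f : StrongDual ℂ A) (a : A) :
    mulBidual n f a = n (mulDual A f a) := rfl

/-- The left Arens product: `⟨m □ n, f⟩ = ⟨m, n · f⟩`. -/
def leftArens (m n : StrongDual ℂ (StrongDual ℂ A)) : StrongDual ℂ (StrongDual ℂ A) :=
  m.comp (bidualMul n)

/-- The right Arens product: `⟨m ◇ n, f⟩ = ⟨n, f · m⟩`. -/
def rightArens (m n : StrongDual ℂ (StrongDual ℂ A)) : StrongDual ℂ (StrongDual ℂ A) :=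
  n.comp (mulBidual m)

variable (A)

/-- Arens regularity: the two Arens products on the second dual coincide. -/
def IsArensRegular : Prop :=
  ∀ m n : StrongDual ℂ (StrongDual ℂ A), leftArens m n = rightArens m n

end Arens

/-! ### Means attached to a character -/

section Means

variable {A}

/-- A character `φ`, as an element of the dual Banach space. -/
def charDual (φ : WeakDual.characterSpace ℂ A) : StrongDual ℂ A :=
  WeakDual.toStrongDual (φ : WeakDual ℂ A)

/-- Topologically two-sided invariant `φ`-means on `A*`. -/
structure IsTwoSidedMean (φ : WeakDual.characterSpace ℂ A)
    (m : StrongDual ℂ (StrongDual ℂ A)) : Prop where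
  map_char : m (charDual φ) = 1
  left_inv : ∀ (f : StrongDual ℂ A) (a : A), m (dualMul A f a) = φ a * m f
  right_inv : ∀ (f : StrongDual ℂ A) (a : A), m (mulDual A f a) = φ a * m f

/-- `A` is two-sided `φ`-amenable. -/
def IsTwoSidedAmenable (φ : WeakDual.characterSpace ℂ A) : Prop :=
  ∃ m : StrongDual ℂ (StrongDual ℂ A), IsTwoSidedMean φ m

/-- The augmentation ideal `I_φ = {a | φ a = 0}`, as a subspace. -/
def augIdeal (φ : WeakDual.characterSpace ℂ A) : Submodule ℂ A :=
  LinearMap.ker (charDual φ).toLinearMap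

/-- The closed linear span of the set of products `a b` with `a ∈ A` and `b ∈ I_φ`. -/
def closedSpanMulAugIdeal (φ : WeakDual.characterSpace ℂ A) : Submodule ℂ A :=
  (Submodule.span ℂ {x : A | ∃ a b : A, b ∈ augIdeal φ ∧ x = a * b}).topologicalClosure

end Means

/-! ### The multiplier norm and the completion `A_M` -/

section Multiplier

variable {A}

/-- The multiplier seminorm `sup {‖a b‖, ‖b a‖ : ‖b‖ ≤ 1}`. -/
def multiplierNorm (a : A) : ℝ :=
  sSup {r : ℝ | ∃ b : A, ‖b‖ ≤ 1 ∧ (r = ‖a * b‖ ∨ r = ‖b * a‖)}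

theorem multiplierNorm_eq_max (a : A) :
    multiplierNorm a =
      max ‖ContinuousLinearMap.mul ℂ A a‖ ‖(ContinuousLinearMap.mul ℂ A).flip a‖ := by
  have hb : BddAbove {r : ℝ | ∃ b : A, ‖b‖ ≤ 1 ∧ (r = ‖a * b‖ ∨ r = ‖b * a‖)} := by
    refine ⟨‖a‖, ?_⟩
    rintro r ⟨b, hb, rfl | rfl⟩
    · exact (norm_mul_le _ _).trans (mul_le_of_le_one_right (norm_nonneg _) hb)
    · exact (norm_mul_le _ _).trans (mul_le_of_le_one_left (norm_nonneg _) hb)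
  have h0 : 0 ≤ multiplierNorm a := le_csSup hb ⟨0, by simp, Or.inl (by simp)⟩
  apply le_antisymm
  · refine csSup_le ⟨0, 0, by simp, Or.inl (by simp)⟩ ?_
    rintro r ⟨b, hb, rfl | rfl⟩
    · exact le_max_of_le_left ((ContinuousLinearMap.mul ℂ A a).unit_le_opNorm b hb)
    · exact le_max_of_le_right (((ContinuousLinearMap.mul ℂ A).flip a).unit_le_opNorm b hb)
  · refine max_le ?_ ?_
    · refine ContinuousLinearMap.opNorm_le_of_unit_norm h0 fun b hb1 => ?_
      exact le_csSup hb ⟨b, hb1.le, Or.inl rfl⟩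
    · refine ContinuousLinearMap.opNorm_le_of_unit_norm h0 fun b hb1 => ?_
      exact le_csSup hb ⟨b, hb1.le, Or.inr rfl⟩

theorem norm_mul_le_multiplierNorm (a b : A) : ‖a * b‖ ≤ multiplierNorm a * ‖b‖ := by
  rw [multiplierNorm_eq_max]
  exact ((ContinuousLinearMap.mul ℂ A a).le_opNorm b).trans
    (mul_le_mul_of_nonneg_right (le_max_left _ _) (norm_nonneg _))

theorem norm_mul_le_multiplierNorm' (a b : A) : ‖b * a‖ ≤ multiplierNorm a * ‖b‖ := by
  rw [multiplierNorm_eq_max]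
  exact (((ContinuousLinearMap.mul ℂ A).flip a).le_opNorm b).trans
    (mul_le_mul_of_nonneg_right (le_max_right _ _) (norm_nonneg _))

theorem multiplierNorm_nonneg (a : A) : 0 ≤ multiplierNorm a := by
  rw [multiplierNorm_eq_max]
  exact le_max_of_le_left (norm_nonneg _)

theorem multiplierNorm_le (a : A) {C : ℝ} (hC : 0 ≤ C)
    (h1 : ∀ b, ‖a * b‖ ≤ C * ‖b‖) (h2 : ∀ b, ‖b * a‖ ≤ C * ‖b‖) : multiplierNorm a ≤ C := by
  rw [multiplierNorm_eq_max]
  exact max_le (ContinuousLinearMap.opNorm_le_bound _ hC h1)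
    (ContinuousLinearMap.opNorm_le_bound _ hC h2)

theorem multiplierNorm_mul_le (a b : A) :
    multiplierNorm (a * b) ≤ multiplierNorm a * multiplierNorm b := by
  refine multiplierNorm_le _ (mul_nonneg (multiplierNorm_nonneg a) (multiplierNorm_nonneg b))
    (fun c => ?_) (fun c => ?_)
  · rw [mul_assoc, mul_assoc]
    exact (norm_mul_le_multiplierNorm a _).trans
      (mul_le_mul_of_nonneg_left (norm_mul_le_multiplierNorm b c) (multiplierNorm_nonneg a))
  · rw [← mul_assoc, mul_comm (multiplierNorm a), mul_assoc (multiplierNorm b)]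
    exact (norm_mul_le_multiplierNorm' b _).trans
      (mul_le_mul_of_nonneg_left (norm_mul_le_multiplierNorm' a c) (multiplierNorm_nonneg b))

/-- The multiplier seminorm is a seminorm. -/
def multiplierSeminorm : Seminorm ℂ A :=
  Seminorm.of multiplierNorm
    (fun a b => by
      refine multiplierNorm_le _ (add_nonneg (multiplierNorm_nonneg a) (multiplierNorm_nonneg b))
        (fun c => ?_) (fun c => ?_)
      · rw [add_mul, add_mul]
        exact (norm_add_le _ _).trans
          (add_le_add (norm_mul_le_multiplierNorm a c) (norm_mul_le_multiplierNorm b c))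
      · rw [mul_add, add_mul]
        exact (norm_add_le _ _).trans
          (add_le_add (norm_mul_le_multiplierNorm' a c) (norm_mul_le_multiplierNorm' b c)))
    (fun k a => by
      rw [multiplierNorm_eq_max, multiplierNorm_eq_max, map_smul, map_smul, norm_smul, norm_smul,
        mul_max_of_nonneg _ _ (norm_nonneg k)])

variable (A)

/-- A copy of the algebra `A`, to be normed by the multiplier norm. -/
def WithMultiplierNorm : Type _ := A

instance : NonUnitalRing (WithMultiplierNorm A) := inferInstanceAs (NonUnitalRing A)

instance : Module ℂ (WithMultiplierNorm A) := inferInstanceAs (Module ℂ A)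

instance : IsScalarTower ℂ (WithMultiplierNorm A) (WithMultiplierNorm A) :=
  inferInstanceAs (IsScalarTower ℂ A A)

instance : SMulCommClass ℂ (WithMultiplierNorm A) (WithMultiplierNorm A) :=
  inferInstanceAs (SMulCommClass ℂ A A)

/-- The multiplier norm on the copy of `A`. -/
def WithMultiplierNorm.addGroupSeminorm : AddGroupSeminorm (WithMultiplierNorm A) :=
  (multiplierSeminorm (A := A)).toAddGroupSeminorm

instance : NonUnitalSeminormedRing (WithMultiplierNorm A) :=
  { (inferInstance : NonUnitalRing (WithMultiplierNorm A)),
    (WithMultiplierNorm.addGroupSeminorm A).toSeminormedAddCommGroup with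
    norm_mul_le := multiplierNorm_mul_le (A := A) }

instance : NormedSpace ℂ (WithMultiplierNorm A) where
  norm_smul_le k a := (map_smul_eq_mul (multiplierSeminorm (A := A)) k a).le

/-- `A_M`: the completion of `A` with respect to the multiplier norm. -/
def MultiplierCompletion : Type _ := UniformSpace.Completion (WithMultiplierNorm A)

namespace MultiplierCompletion

instance : NormedAddCommGroup (MultiplierCompletion A) :=
  inferInstanceAs (NormedAddCommGroup (UniformSpace.Completion (WithMultiplierNorm A)))

instance : NormedSpace ℂ (MultiplierCompletion A) :=
  inferInstanceAs (NormedSpace ℂ (UniformSpace.Completion (WithMultiplierNorm A)))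

instance : CompleteSpace (MultiplierCompletion A) :=
  inferInstanceAs (CompleteSpace (UniformSpace.Completion (WithMultiplierNorm A)))

variable {A}

/-- The canonical linear map `i : A → A_M`. -/
def incl : A →ₗ[ℂ] MultiplierCompletion A :=
  (UniformSpace.Completion.toComplL : WithMultiplierNorm A →L[ℂ]
    UniformSpace.Completion (WithMultiplierNorm A)).toLinearMap

theorem norm_incl (a : A) : ‖incl a‖ = multiplierNorm a :=
  UniformSpace.Completion.norm_coe (E := WithMultiplierNorm A) a

theorem denseRange_incl : DenseRange (incl : A → MultiplierCompletion A) :=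
  UniformSpace.Completion.denseRange_coe (α := WithMultiplierNorm A)

/-- The product of `A_M`: the continuous extension of the product of `A`. -/
instance : Mul (MultiplierCompletion A) :=
  ⟨fun x y => (UniformSpace.Completion.isDenseInducing_coe.prodMap
    UniformSpace.Completion.isDenseInducing_coe).extend
      (fun p : WithMultiplierNorm A × WithMultiplierNorm A =>
        ((p.1 * p.2 : WithMultiplierNorm A) :
          UniformSpace.Completion (WithMultiplierNorm A))) (x, y)⟩

theorem incl_mul (a b : A) : incl (a * b) = incl a * incl b :=
  ((UniformSpace.Completion.isDenseInducing_coe.prodMap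
    UniformSpace.Completion.isDenseInducing_coe).extend_eq
      ((UniformSpace.Completion.continuous_coe (WithMultiplierNorm A)).comp
        continuous_mul) (a, b)).symm

theorem continuous_mul' : Continuous fun p : MultiplierCompletion A × MultiplierCompletion A =>
    p.1 * p.2 := by
  let m := (AddMonoidHom.mul : WithMultiplierNorm A →+ WithMultiplierNorm A →+
    WithMultiplierNorm A).compr₂ UniformSpace.Completion.toCompl
  have hm : Continuous fun p : WithMultiplierNorm A × WithMultiplierNorm A => m p.1 p.2 :=
    (UniformSpace.Completion.continuous_coe (WithMultiplierNorm A)).comp continuous_mul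
  have di : IsDenseInducing (UniformSpace.Completion.toCompl : WithMultiplierNorm A →
    UniformSpace.Completion (WithMultiplierNorm A)) :=
      UniformSpace.Completion.isDenseInducing_coe
  exact di.extend_Z_bilin di hm

instance : ContinuousMul (MultiplierCompletion A) := ⟨continuous_mul'⟩

theorem induction₁ {p : MultiplierCompletion A → Prop} (hp : IsClosed {x | p x})
    (h : ∀ a : A, p (incl a)) (x : MultiplierCompletion A) : p x :=
  denseRange_incl.induction_on x hp h

theorem induction₂ {p : MultiplierCompletion A → MultiplierCompletion A → Prop}
    (hp : IsClosed {q : MultiplierCompletion A × MultiplierCompletion A | p q.1 q.2})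
    (h : ∀ a b : A, p (incl a) (incl b)) (x y : MultiplierCompletion A) : p x y :=
  denseRange_incl.induction_on₂ hp h x y

theorem induction₃
    {p : MultiplierCompletion A → MultiplierCompletion A → MultiplierCompletion A → Prop}
    (hp : IsClosed {q : MultiplierCompletion A × MultiplierCompletion A × MultiplierCompletion A |
      p q.1 q.2.1 q.2.2})
    (h : ∀ a b c : A, p (incl a) (incl b) (incl c)) (x y z : MultiplierCompletion A) : p x y z :=
  denseRange_incl.induction_on₃ hp h x y z

theorem zero_mul' (x : MultiplierCompletion A) : 0 * x = 0 := by
  refine induction₁ (p := fun x => 0 * x = 0) (isClosed_eq (by fun_prop) (by fun_prop))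
    (fun a => ?_) x
  rw [← map_zero incl, ← incl_mul, zero_mul]

theorem mul_zero' (x : MultiplierCompletion A) : x * 0 = 0 := by
  refine induction₁ (p := fun x => x * 0 = 0) (isClosed_eq (by fun_prop) (by fun_prop))
    (fun a => ?_) x
  rw [← map_zero incl, ← incl_mul, mul_zero]

theorem mul_assoc' (x y z : MultiplierCompletion A) : x * y * z = x * (y * z) := by
  refine induction₃ (p := fun x y z => x * y * z = x * (y * z))
    (isClosed_eq (by fun_prop) (by fun_prop)) (fun a b c => ?_) x y z
  simp only [← incl_mul, mul_assoc]

theorem mul_add' (x y z : MultiplierCompletion A) : x * (y + z) = x * y + x * z := by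
  refine induction₃ (p := fun x y z => x * (y + z) = x * y + x * z)
    (isClosed_eq (by fun_prop) (by fun_prop)) (fun a b c => ?_) x y z
  rw [← map_add incl b c, ← incl_mul, mul_add, map_add, incl_mul, incl_mul]

theorem add_mul' (x y z : MultiplierCompletion A) : (x + y) * z = x * z + y * z := by
  refine induction₃ (p := fun x y z => (x + y) * z = x * z + y * z)
    (isClosed_eq (by fun_prop) (by fun_prop)) (fun a b c => ?_) x y z
  rw [← map_add incl a b, ← incl_mul, add_mul, map_add, incl_mul, incl_mul]

theorem norm_mul_le' (x y : MultiplierCompletion A) : ‖x * y‖ ≤ ‖x‖ * ‖y‖ := by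
  refine induction₂ (p := fun x y => ‖x * y‖ ≤ ‖x‖ * ‖y‖)
    (isClosed_le (by fun_prop) (by fun_prop)) (fun a b => ?_) x y
  rw [← incl_mul, norm_incl, norm_incl, norm_incl]
  exact multiplierNorm_mul_le a b

theorem smul_mul' (k : ℂ) (x y : MultiplierCompletion A) : (k • x) * y = k • (x * y) := by
  refine induction₂ (p := fun x y => (k • x) * y = k • (x * y))
    (isClosed_eq ((continuous_fst.const_smul k).mul continuous_snd)
      ((continuous_fst.mul continuous_snd).const_smul k)) (fun a b => ?_) x y
  simp only [← incl_mul, ← map_smul, smul_mul_assoc]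

theorem mul_smul' (k : ℂ) (x y : MultiplierCompletion A) : x * (k • y) = k • (x * y) := by
  refine induction₂ (p := fun x y => x * (k • y) = k • (x * y))
    (isClosed_eq (continuous_fst.mul (continuous_snd.const_smul k))
      ((continuous_fst.mul continuous_snd).const_smul k)) (fun a b => ?_) x y
  simp only [← incl_mul, ← map_smul, mul_smul_comm]

instance : NonUnitalNormedRing (MultiplierCompletion A) :=
  { (inferInstance : NormedAddCommGroup (MultiplierCompletion A)) with
    mul := (· * ·)
    zero_mul := zero_mul'
    mul_zero := mul_zero'
    mul_assoc := mul_assoc'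
    left_distrib := mul_add'
    right_distrib := add_mul'
    norm_mul_le := norm_mul_le' }

instance : IsScalarTower ℂ (MultiplierCompletion A) (MultiplierCompletion A) :=
  ⟨fun k x y => smul_mul' k x y⟩

instance : SMulCommClass ℂ (MultiplierCompletion A) (MultiplierCompletion A) :=
  ⟨fun k x y => (mul_smul' k x y).symm⟩

end MultiplierCompletion

end Multiplier

end BanachMean

end

/-!
The second adjoint `T** : A** → B**` of a continuous homomorphism `T : A → B` is multiplicative for
both Arens products. If `n` is a left and `m` a right invariant `φ`-mean on `A*`, then `m □ n = n`
and `m ◇ n = m`, so Arens regularity of `B` forces `T** m = T** n`. For `T` the canonical map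
`A → A_M`, every functional `f · a` factors through `T`, hence `m (f · a) = n (f · a)`; if `m` is
also left invariant, `φ a = 1` gives `m f = n f`. Thus a two-sided mean is the only left mean.

By Hahn–Banach and separability, a left mean `m` yields a bounded sequence `u` in `A` with
`φ (u n) → 1` and `a * u n - φ a • u n → 0` in norm for `a` in a dense set. Each weak* cluster point
of `u` in `A**` is a left mean. If `m` is the only one, then `u` converges weak* to `m`; so `u` is
weakly Cauchy, and weak sequential completeness puts `m` in `A`.
-/

namespace BanachMean

section SecondAdjoint

variable {𝕜 E F : Type*} [RCLike 𝕜] [SeminormedAddCommGroup E] [NormedSpace 𝕜 E]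
  [SeminormedAddCommGroup F] [NormedSpace 𝕜 F]

theorem mul_norm_le_of_forall_re_le (f : StrongDual 𝕜 E) {r s : ℝ} (hr : 0 ≤ r)
    (h : ∀ x, ‖x‖ ≤ r → RCLike.re (f x) ≤ s) : r * ‖f‖ ≤ s := by
  have hs : 0 ≤ s := by simpa using h 0 (by simpa using hr)
  suffices ‖(r : 𝕜) • f‖ ≤ s by simpa [norm_smul, abs_of_nonneg hr] using this
  refine ContinuousLinearMap.opNorm_le_of_unit_norm hs fun x hx => ?_
  obtain ⟨c, hc, hcx⟩ := RCLike.exists_norm_eq_mul_self (f x)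
  have hfx : f ((r : 𝕜) • c • x) = ((r * ‖f x‖ : ℝ) : 𝕜) := by
    rw [map_smul f, map_smul f, smul_eq_mul, smul_eq_mul, ← hcx, RCLike.ofReal_mul]
  have hre := h ((r : 𝕜) • c • x) (by simp [norm_smul, hc, hx, abs_of_nonneg hr])
  rw [hfx, RCLike.ofReal_re] at hre
  simpa [abs_of_nonneg hr] using hre

/-- The second adjoint `T** : E** → F**` of a continuous linear map `T : E → F`, along which means
are transported. The equation `bidualMap T m = inclusionInDoubleDual 𝕜 F y` says that `T**` sends
`m` to a point of `F`. -/
noncomputable def bidualMap (T : E →L[𝕜] F) :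
    StrongDual 𝕜 (StrongDual 𝕜 E) →L[𝕜] StrongDual 𝕜 (StrongDual 𝕜 F) :=
  ContinuousLinearMap.precomp 𝕜 (ContinuousLinearMap.precomp 𝕜 T)

@[simp] theorem bidualMap_apply (T : E →L[𝕜] F) (m : StrongDual 𝕜 (StrongDual 𝕜 E))
    (g : StrongDual 𝕜 F) : bidualMap T m g = m (g.comp T) := rfl

theorem mem_closure_image_closedBall_of_bidualMap_eq {T : E →L[𝕜] F}
    {m : StrongDual 𝕜 (StrongDual 𝕜 E)} {y : F}
    (h : bidualMap T m = NormedSpace.inclusionInDoubleDual 𝕜 F y) :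
    y ∈ closure (T '' Metric.closedBall 0 ‖m‖) := by
  let : NormedSpace ℝ E := NormedSpace.restrictScalars ℝ 𝕜 E
  let : NormedSpace ℝ F := NormedSpace.restrictScalars ℝ 𝕜 F
  have : IsScalarTower ℝ 𝕜 E := RestrictScalars.isScalarTower ℝ 𝕜 E
  have : IsScalarTower ℝ 𝕜 F := RestrictScalars.isScalarTower ℝ 𝕜 F
  by_contra hy
  have hconvex : Convex ℝ (T '' Metric.closedBall 0 ‖m‖) :=
    (convex_closedBall (0 : E) ‖m‖).linear_image (T.restrictScalars ℝ).toLinearMap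
  obtain ⟨g, s, hball, hsy⟩ :=
    RCLike.geometric_hahn_banach_closed_point (𝕜 := 𝕜) hconvex.closure isClosed_closure hy
  refine hsy.not_ge ?_
  calc RCLike.re (g y) = RCLike.re (m (g.comp T)) :=
        congrArg RCLike.re (DFunLike.congr_fun h g).symm
    _ ≤ ‖m (g.comp T)‖ := RCLike.re_le_norm _
    _ ≤ ‖m‖ * ‖g.comp T‖ := m.le_opNorm _
    _ ≤ s := mul_norm_le_of_forall_re_le _ (norm_nonneg m) fun x hx =>
      (hball (T x) (subset_closure ⟨x, mem_closedBall_zero_iff.2 hx, rfl⟩)).le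

section Pi

variable {ι : Type*} {G : ι → Type*} [∀ i, SeminormedAddCommGroup (G i)]
  [∀ i, NormedSpace 𝕜 (G i)] {T : ∀ i, E →L[𝕜] G i} {m : StrongDual 𝕜 (StrongDual 𝕜 E)}
  {y : ∀ i, G i}

theorem bidualMap_pi_eq [Fintype ι]
    (h : ∀ i, bidualMap (T i) m = NormedSpace.inclusionInDoubleDual 𝕜 (G i) (y i)) :
    bidualMap (ContinuousLinearMap.pi T) m = NormedSpace.inclusionInDoubleDual 𝕜 _ y := by
  classical
  ext g
  let gᵢ (i : ι) : StrongDual 𝕜 (G i) := g.comp (ContinuousLinearMap.single 𝕜 G i)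
  have hg (v : ∀ i, G i) : ∑ i, gᵢ i (v i) = g v := g.sum_comp_single 𝕜 G v
  have hcomp : g.comp (ContinuousLinearMap.pi T) = ∑ i, (gᵢ i).comp (T i) := by
    ext x
    simpa using (hg fun i => T i x).symm
  rw [bidualMap_apply, hcomp, map_sum, NormedSpace.dual_def, ← hg y]
  exact Finset.sum_congr rfl fun i _ => DFunLike.congr_fun (h i) (gᵢ i)

theorem exists_seq_tendsto_of_bidualMap_eq [Countable ι]
    (h : ∀ i, bidualMap (T i) m = NormedSpace.inclusionInDoubleDual 𝕜 (G i) (y i)) :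
    ∃ u : ℕ → E, (∀ n, ‖u n‖ ≤ ‖m‖) ∧ ∀ i, Tendsto (fun n => T i (u n)) atTop (𝓝 (y i)) := by
  have hy : y ∈ closure ((fun x i => T i x) '' Metric.closedBall 0 ‖m‖) := by
    refine mem_closure_iff_nhds.2 fun V hV => ?_
    rw [nhds_pi, mem_pi] at hV
    obtain ⟨I, hI, W, hW, hWV⟩ := hV
    have := hI.fintype
    have hclosure := mem_closure_image_closedBall_of_bidualMap_eq
      (bidualMap_pi_eq (T := fun i : I => T i) fun i => h i)
    obtain ⟨_, hxW, x, hx, rfl⟩ := mem_closure_iff_nhds.1 hclosure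
      (Set.univ.pi fun i : I => W i) (set_pi_mem_nhds Set.finite_univ fun i _ => hW i)
    exact ⟨_, hWV fun i hi => hxW ⟨i, hi⟩ trivial, x, hx, rfl⟩
  obtain ⟨v, hv, hvy⟩ := mem_closure_iff_seq_limit.1 hy
  choose u hu huv using hv
  refine ⟨u, fun n => mem_closedBall_zero_iff.1 (hu n), fun i => ?_⟩
  simpa only [← huv] using tendsto_pi_nhds.1 hvy i

end Pi

theorem tendsto_apply_of_forall_ultrafilter_eq {ι : Type*} {l : Filter ι} {u : ι → E} {C : ℝ}
    (hu : ∀ i, ‖u i‖ ≤ C) {m : StrongDual 𝕜 (StrongDual 𝕜 E)}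
    (h : ∀ (U : Ultrafilter ι) (p : StrongDual 𝕜 (StrongDual 𝕜 E)), ↑U ≤ l →
      (∀ f : StrongDual 𝕜 E, Tendsto (fun i => f (u i)) U (𝓝 (p f))) → p = m)
    (f : StrongDual 𝕜 E) : Tendsto (fun i => f (u i)) l (𝓝 (m f)) := by
  let v (i : ι) : WeakDual 𝕜 (StrongDual 𝕜 E) :=
    StrongDual.toWeakDual (NormedSpace.inclusionInDoubleDual 𝕜 E (u i))
  suffices hv : Tendsto v l (𝓝 (StrongDual.toWeakDual m)) from
    ((WeakDual.eval_continuous f).tendsto _).comp hv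
  refine (WeakDual.isCompact_closedBall (𝕜 := 𝕜) (E := StrongDual 𝕜 E) 0
    C).tendsto_nhds_of_unique_mapClusterPt (Eventually.of_forall fun i => ?_) fun p _ hp => ?_
  · simpa [v] using (NormedSpace.double_dual_bound 𝕜 E (u i)).trans (hu i)
  · obtain ⟨U, hU, hUp⟩ := mapClusterPt_iff_ultrafilter.1 hp
    exact congrArg StrongDual.toWeakDual (h U (WeakDual.toStrongDual p) hU fun g =>
      ((WeakDual.eval_continuous g).tendsto p).comp hUp)

end SecondAdjoint

section Character

variable {A : Type*} [NonUnitalNormedRing A] [NormedSpace ℂ A]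

theorem exists_character_eq_one (φ : WeakDual.characterSpace ℂ A) : ∃ a : A, φ a = 1 := by
  obtain ⟨a, ha⟩ : ∃ a : A, φ a ≠ 0 := by
    by_contra! h
    exact φ.2.1 (DFunLike.ext _ _ h)
  exact ⟨(φ a)⁻¹ • a, by rw [map_smul, smul_eq_mul, inv_mul_cancel₀ ha]⟩

@[simp] theorem charDual_apply (φ : WeakDual.characterSpace ℂ A) (a : A) :
    charDual φ a = φ a := rfl

end Character

variable {A : Type*} [NonUnitalNormedRing A] [NormedSpace ℂ A]
  [IsScalarTower ℂ A A] [SMulCommClass ℂ A A]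

section Arens

variable {B : Type*} [NonUnitalNormedRing B] [NormedSpace ℂ B]
  [IsScalarTower ℂ B B] [SMulCommClass ℂ B B] {T : A →L[ℂ] B}

theorem bidualMap_leftArens (hT : ∀ a b, T (a * b) = T a * T b)
    (m n : StrongDual ℂ (StrongDual ℂ A)) :
    bidualMap T (leftArens m n) = leftArens (bidualMap T m) (bidualMap T n) := by
  have hdual (F : StrongDual ℂ B) (a : A) :
      (dualMul B F (T a)).comp T = dualMul A (F.comp T) a := by
    ext b
    simp [hT]
  have hbidual (F : StrongDual ℂ B) :
      (bidualMul (bidualMap T n) F).comp T = bidualMul n (F.comp T) := by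
    ext a
    simp [hdual]
  ext F
  simp [leftArens, hbidual]

theorem bidualMap_rightArens (hT : ∀ a b, T (a * b) = T a * T b)
    (m n : StrongDual ℂ (StrongDual ℂ A)) :
    bidualMap T (rightArens m n) = rightArens (bidualMap T m) (bidualMap T n) := by
  have hdual (F : StrongDual ℂ B) (a : A) :
      (mulDual B F (T a)).comp T = mulDual A (F.comp T) a := by
    ext b
    simp [hT]
  have hbidual (F : StrongDual ℂ B) :
      (mulBidual (bidualMap T m) F).comp T = mulBidual m (F.comp T) := by
    ext a
    simp [hdual]
  ext F
  simp [rightArens, hbidual]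

end Arens

section OneSidedMeans

variable {φ : WeakDual.characterSpace ℂ A} {m n : StrongDual ℂ (StrongDual ℂ A)}

/-- Topologically left invariant `φ`-means on `A*`: the one-sided half of `IsTwoSidedMean` given by
the functionals `f · a`. -/
structure IsLeftMean (φ : WeakDual.characterSpace ℂ A)
    (m : StrongDual ℂ (StrongDual ℂ A)) : Prop where
  map_char : m (charDual φ) = 1
  left_inv : ∀ (f : StrongDual ℂ A) (a : A), m (dualMul A f a) = φ a * m f

/-- Topologically right invariant `φ`-means on `A*`: the one-sided half of `IsTwoSidedMean` given by
the functionals `a · f`. -/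
structure IsRightMean (φ : WeakDual.characterSpace ℂ A)
    (m : StrongDual ℂ (StrongDual ℂ A)) : Prop where
  map_char : m (charDual φ) = 1
  right_inv : ∀ (f : StrongDual ℂ A) (a : A), m (mulDual A f a) = φ a * m f

theorem IsTwoSidedMean.isLeftMean (hm : IsTwoSidedMean φ m) : IsLeftMean φ m :=
  ⟨hm.map_char, hm.left_inv⟩

theorem IsTwoSidedMean.isRightMean (hm : IsTwoSidedMean φ m) : IsRightMean φ m :=
  ⟨hm.map_char, hm.right_inv⟩

theorem IsLeftMean.leftArens_eq (hn : IsLeftMean φ n) (m : StrongDual ℂ (StrongDual ℂ A)) :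
    leftArens m n = m (charDual φ) • n := by
  ext f
  have hf : bidualMul n f = n f • charDual φ := by
    ext a
    simp [hn.left_inv, mul_comm]
  simp [leftArens, hf, mul_comm]

theorem IsRightMean.rightArens_eq (hm : IsRightMean φ m) (n : StrongDual ℂ (StrongDual ℂ A)) :
    rightArens m n = n (charDual φ) • m := by
  ext f
  have hf : mulBidual m f = m f • charDual φ := by
    ext a
    simp [hm.right_inv, mul_comm]
  simp [rightArens, hf, mul_comm]

theorem IsLeftMean.bidualMap_eq_of_isRightMean {B : Type*} [NonUnitalNormedRing B]
    [NormedSpace ℂ B] [IsScalarTower ℂ B B] [SMulCommClass ℂ B B] (hB : IsArensRegular B)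
    {T : A →L[ℂ] B} (hT : ∀ a b, T (a * b) = T a * T b)
    (hn : IsLeftMean φ n) (hm : IsRightMean φ m) : bidualMap T n = bidualMap T m :=
  calc bidualMap T n = bidualMap T (leftArens m n) := by
        rw [hn.leftArens_eq, hm.map_char, one_smul]
    _ = leftArens (bidualMap T m) (bidualMap T n) := bidualMap_leftArens hT m n
    _ = rightArens (bidualMap T m) (bidualMap T n) := hB _ _
    _ = bidualMap T (rightArens m n) := (bidualMap_rightArens hT m n).symm
    _ = bidualMap T m := by rw [hm.rightArens_eq, hn.map_char, one_smul]

end OneSidedMeans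

section MultiplierCompletion

theorem multiplierNorm_le_norm (a : A) : multiplierNorm a ≤ ‖a‖ :=
  multiplierNorm_le a (norm_nonneg a) (fun b => norm_mul_le a b)
    fun b => (norm_mul_le b a).trans_eq (mul_comm _ _)

/-- The canonical map `A → A_M` of `MultiplierCompletion.incl` as a continuous linear map for the
original norm of `A`. -/
noncomputable def inclL : A →L[ℂ] MultiplierCompletion A :=
  MultiplierCompletion.incl.mkContinuous 1 fun a => by
    rw [MultiplierCompletion.norm_incl, one_mul]
    exact multiplierNorm_le_norm a

theorem inclL_mul (a b : A) : inclL (a * b) = inclL a * inclL b :=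
  MultiplierCompletion.incl_mul a b

theorem exists_comp_inclL_eq {E : Type*} [NormedAddCommGroup E] [NormedSpace ℂ E] [CompleteSpace E]
    {f : A →L[ℂ] E} {C : ℝ} (hf : ∀ a, ‖f a‖ ≤ C * multiplierNorm a) :
    ∃ F : MultiplierCompletion A →L[ℂ] E, F.comp inclL = f := by
  let f₀ : WithMultiplierNorm A →ₗ[ℂ] E := (f.toLinearMap : A →ₗ[ℂ] E)
  let f₁ : WithMultiplierNorm A →L[ℂ] E := f₀.mkContinuous C hf
  let i : WithMultiplierNorm A →L[ℂ] UniformSpace.Completion (WithMultiplierNorm A) :=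
    UniformSpace.Completion.toComplL
  have hdense : DenseRange i := UniformSpace.Completion.denseRange_coe
  have hunif : IsUniformInducing i := UniformSpace.Completion.isUniformInducing_coe _
  have hextend (a : WithMultiplierNorm A) : f₁.extend i (i a) = f₁ a :=
    f₁.extend_eq hdense hunif a
  exact ⟨(f₁.extend i : UniformSpace.Completion (WithMultiplierNorm A) →L[ℂ] E),
    ContinuousLinearMap.ext hextend⟩

theorem exists_comp_inclL_eq_dualMul (f : StrongDual ℂ A) (a : A) :
    ∃ F : StrongDual ℂ (MultiplierCompletion A), F.comp inclL = dualMul A f a := by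
  refine exists_comp_inclL_eq (C := ‖f‖ * ‖a‖) fun b => ?_
  calc ‖f (a * b)‖ ≤ ‖f‖ * ‖a * b‖ := f.le_opNorm _
    _ ≤ ‖f‖ * (multiplierNorm b * ‖a‖) := by
      gcongr
      exact norm_mul_le_multiplierNorm' b a
    _ = ‖f‖ * ‖a‖ * multiplierNorm b := by ring

theorem IsLeftMean.eq_of_isTwoSidedMean {φ : WeakDual.characterSpace ℂ A}
    {m n : StrongDual ℂ (StrongDual ℂ A)} (hreg : IsArensRegular (MultiplierCompletion A))
    (hn : IsLeftMean φ n) (hm : IsTwoSidedMean φ m) : n = m := by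
  obtain ⟨a, ha⟩ := exists_character_eq_one φ
  ext f
  obtain ⟨F, hF⟩ := exists_comp_inclL_eq_dualMul f a
  calc n f = n (dualMul A f a) := by rw [hn.left_inv, ha, one_mul]
    _ = bidualMap inclL n F := by rw [bidualMap_apply, hF]
    _ = bidualMap inclL m F := by
      rw [hn.bidualMap_eq_of_isRightMean hreg inclL_mul hm.isRightMean]
    _ = m (dualMul A f a) := by rw [bidualMap_apply, hF]
    _ = m f := by rw [hm.left_inv, ha, one_mul]

end MultiplierCompletion

section ApproximateMeans

variable {φ : WeakDual.characterSpace ℂ A} {m : StrongDual ℂ (StrongDual ℂ A)}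

theorem IsLeftMean.exists_seq_tendsto (hm : IsLeftMean φ m) {ι : Type*} [Countable ι] (d : ι → A) :
    ∃ u : ℕ → A, (∀ n, ‖u n‖ ≤ ‖m‖) ∧ Tendsto (fun n => φ (u n)) atTop (𝓝 1) ∧
      ∀ i, Tendsto (fun n => d i * u n - φ (d i) • u n) atTop (𝓝 0) := by
  obtain ⟨e, he⟩ := exists_character_eq_one φ
  -- `φ (u n) → 1` is encoded as `K (u n) → e`, so that all the conditions take values in `A`.
  let K : A →L[ℂ] A := (charDual φ).smulRight e
  let L (i : ι) : A →L[ℂ] A :=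
    ContinuousLinearMap.mul ℂ A (d i) - φ (d i) • ContinuousLinearMap.id ℂ A
  have hK : bidualMap K m = NormedSpace.inclusionInDoubleDual ℂ A e := by
    ext f
    have hf : f.comp K = f e • charDual φ := by
      ext a
      simp [K, mul_comm]
    simp [hf, hm.map_char]
  have hL (i : ι) : bidualMap (L i) m = NormedSpace.inclusionInDoubleDual ℂ A 0 := by
    ext f
    have hf : f.comp (L i) = dualMul A f (d i) - φ (d i) • f := by
      ext a
      simp [L]
    simp [hf, hm.left_inv]
  obtain ⟨u, hbound, hu⟩ := exists_seq_tendsto_of_bidualMap_eq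
    (T := fun o : Option ι => o.elim K L) (y := fun o => o.elim e 0) (Option.rec hK hL)
  refine ⟨u, hbound, ?_, fun i => hu (some i)⟩
  have hφu := ((charDual φ).continuous.tendsto e).comp (hu none)
  simpa [Function.comp_def, K, he] using hφu

theorem IsLeftMean.of_tendsto {ι : Type*} {l : Filter ι} [l.NeBot] {u : ι → A} {D : Set A}
    (hD : Dense D) (hφ : Tendsto (fun i => φ (u i)) l (𝓝 1))
    (hleft : ∀ d ∈ D, Tendsto (fun i => d * u i - φ d • u i) l (𝓝 0))
    (hm : ∀ f : StrongDual ℂ A, Tendsto (fun i => f (u i)) l (𝓝 (m f))) :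
    IsLeftMean φ m where
  map_char := tendsto_nhds_unique (hm (charDual φ)) hφ
  left_inv f := by
    refine congrFun (Continuous.ext_on hD ?_ ?_ fun d hd => ?_)
    · fun_prop
    · exact (map_continuous φ).mul_const _
    · have hlim := (f.continuous.tendsto 0).comp (hleft d hd)
      refine sub_eq_zero.1 (tendsto_nhds_unique
        ((hm (dualMul A f d)).sub ((hm f).const_mul (φ d))) ?_)
      simpa [Function.comp_def] using hlim

theorem IsLeftMean.exists_inclusionInDoubleDual_eq [TopologicalSpace.SeparableSpace A]
    (hA : IsWeaklySequentiallyComplete A) (hm : IsLeftMean φ m)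
    (huniq : ∀ n, IsLeftMean φ n → n = m) :
    ∃ u : A, NormedSpace.inclusionInDoubleDual ℂ A u = m := by
  obtain ⟨u, hbound, hφ, hleft⟩ := hm.exists_seq_tendsto (TopologicalSpace.denseSeq A)
  have hu : ∀ f : StrongDual ℂ A, Tendsto (fun n => f (u n)) atTop (𝓝 (m f)) :=
    tendsto_apply_of_forall_ultrafilter_eq hbound fun U p hU hp =>
      huniq p (.of_tendsto (TopologicalSpace.denseRange_denseSeq A) (hφ.mono_left hU)
        (Set.forall_mem_range.2 fun k => (hleft k).mono_left hU) hp)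
  obtain ⟨x, hx⟩ := hA u fun f => (hu f).cauchySeq
  exact ⟨x, ContinuousLinearMap.ext fun f => tendsto_nhds_unique (hx f) (hu f)⟩

end ApproximateMeans

end BanachMean

theorem mainTheorem12_general {A : Type*} [NonUnitalNormedRing A] [NormedSpace ℂ A]
    [IsScalarTower ℂ A A] [SMulCommClass ℂ A A] [TopologicalSpace.SeparableSpace A]
    (hwsc : BanachMean.IsWeaklySequentiallyComplete A)
    (φ : WeakDual.characterSpace ℂ A)
    (hamen : BanachMean.IsTwoSidedAmenable φ)
    (hreg : BanachMean.IsArensRegular (BanachMean.MultiplierCompletion A)) :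
    (∃! m : StrongDual ℂ (StrongDual ℂ A), BanachMean.IsTwoSidedMean φ m) ∧
      ∃! u : A, BanachMean.IsTwoSidedMean φ (NormedSpace.inclusionInDoubleDual ℂ A u) := by
  obtain ⟨m, hm⟩ := hamen
  have huniq : ∀ n, BanachMean.IsLeftMean φ n → n = m := fun _ hn => hn.eq_of_isTwoSidedMean hreg hm
  obtain ⟨u, rfl⟩ := hm.isLeftMean.exists_inclusionInDoubleDual_eq hwsc huniq
  have hinj := (NormedSpace.inclusionInDoubleDualLi ℂ (E := A)).injective
  exact ⟨⟨_, hm, fun n hn => huniq n hn.isLeftMean⟩,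
    u, hm, fun v hv => hinj (huniq _ hv.isLeftMean)⟩

theorem mainTheorem12 {A : Type*} [NonUnitalNormedRing A] [NormedSpace ℂ A]
    [IsScalarTower ℂ A A] [SMulCommClass ℂ A A] [CompleteSpace A]
    [TopologicalSpace.SeparableSpace A]
    (hwsc : BanachMean.IsWeaklySequentiallyComplete A)
    (hfaith : BanachMean.IsFaithful A)
    (φ : WeakDual.characterSpace ℂ A)
    (hspan : BanachMean.closedSpanMulAugIdeal φ = BanachMean.augIdeal φ)
    (hamen : BanachMean.IsTwoSidedAmenable φ)
    (hreg : BanachMean.IsArensRegular (BanachMean.MultiplierCompletion A)) :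
    (∃! m : StrongDual ℂ (StrongDual ℂ A), BanachMean.IsTwoSidedMean φ m) ∧
      ∃! u : A, BanachMean.IsTwoSidedMean φ (NormedSpace.inclusionInDoubleDual ℂ A u) :=
  mainTheorem12_general hwsc φ hamen hreg
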